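/- Let $V$ be a finite set. A DAG on $V$ is a directed graph $\mathcal G=(V,E)$ that contains every self-loop $i\to i$ and has no directed cycle of length greater than one. Let $C$ be a diagonal positive definite real $V\times V$ matrix. The graphical continuous Lyapunov model (GCLM) of $\mathcal G$ is given by the set of covariance matrices $$\mathcal M_{\mathcal G,C}=\{\Sigma \text{ positive definite} : M\Sigma+\Sigma M^T+C=0 \text{ for a stable real matrix } M \text{ with } m_{ji}=0 \text{ whenever } i\to j\notin E\},$$ where a matrix is stable if all its complex eigenvalues have negative real part. Two DAGs on $V$ are Lyapunov model equivalent if $\mathcal M_{\mathcal G_1,C}=\mathcal M_{\mathcal G_2,C}$. They are Markov equivalent (as Bayesian networks) if they have the same d-separations: for all pairwise disjoint $A,B,Z\subseteq V$, the set $Z$ d-separates $A$ and $B$ in $\mathcal G_1$ if and only if it does so in $\mathcal G_2$ (where $Z$ d-separates $A$ and $B$ if every path without repeated vertices in the skeleton between a vertex of $A$ and a vertex of $B$ has an inner vertex that either is a non-collider on the path and lies in $Z$, or is a collider on the path and neither it nor any of its descendants lies in $Z$). Then the partition of the set of DAGs on $V$ into Lyapunov model equivalence classes refines the partition into Markov equivalence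 classes. In other words, if two DAGs on $V$ are not Markov equivalent, then they are not Lyapunov model equivalent. In particular this holds for $C=2I$. -/

import Mathlib

/-- A directed acyclic graph on `V`. All self-loops belong to the edge set, and acyclicity is
understood after ignoring them: there is no directed cycle of length greater than one. -/
structure DAG (V : Type*) extends Digraph V where
  loop : ∀ i, Adj i i
  acyclic : ∀ i, ¬ Relation.TransGen (fun a b => a ≠ b ∧ Adj a b) i i

namespace DAG

variable {V : Type*}

/-- The edges `i → j` other than the self-loops. -/
def Arrow (G : DAG V) (i j : V) : Prop := i ≠ j ∧ G.Adj i j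

/-! ### Lyapunov models -/

/-- A real matrix is stable if all its complex eigenvalues have negative real part. -/
def IsStable [Fintype V] [DecidableEq V] (M : Matrix V V ℝ) : Prop :=
  ∀ z ∈ spectrum ℂ (M.map (algebraMap ℝ ℂ)), z.re < 0

/-- The space `ℝ^E` of the matrices `M` with `M j i = 0` whenever `i → j` is not an edge. -/
def sparse (G : DAG V) : Set (Matrix V V ℝ) :=
  {M | ∀ i j, ¬ G.Adj i j → M j i = 0}

/-- The graphical continuous Lyapunov model of `G` with volatility matrix `C`, as the set of
covariance matrices of its centred normal distributions. -/
def lyapunovModel [Fintype V] [DecidableEq V] (C : Matrix V V ℝ) (G : DAG V) :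
    Set (Matrix V V ℝ) :=
  {S | S.PosDef ∧ ∃ M ∈ G.sparse, IsStable M ∧ M * S + S * M.transpose + C = 0}

/-- Model equivalence in the Lyapunov sense. -/
def ModelEquivalent [Fintype V] [DecidableEq V] (C : Matrix V V ℝ) (G₁ G₂ : DAG V) : Prop :=
  lyapunovModel C G₁ = lyapunovModel C G₂

/-- Model equivalence as an equivalence relation on the DAGs on `V`. -/
def modelSetoid [Fintype V] [DecidableEq V] (C : Matrix V V ℝ) : Setoid (DAG V) where
  r := ModelEquivalent C
  iseqv := ⟨fun _ => rfl, fun h => Eq.symm h, fun h h' => Eq.trans h h'⟩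

/-! ### Markov equivalence -/

/-- The skeleton: the undirected simple graph obtained by dropping loops and orientations. -/
def skeleton (G : DAG V) : SimpleGraph V := G.toDigraph.toSimpleGraphInclusive

/-- `Z` does not block the walk `p`: every inner vertex of `p` at which two arrows meet head to
head is in `Z` or has a descendant in `Z`, and no other inner vertex of `p` is in `Z`. -/
def IsActive (G : DAG V) (Z : Set V) {a b : V} (p : G.skeleton.Walk a b) : Prop :=
  ∀ k, k + 2 ≤ p.length →
    ((G.Arrow (p.getVert k) (p.getVert (k + 1)) ∧
        G.Arrow (p.getVert (k + 2)) (p.getVert (k + 1))) →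
      ∃ d ∈ Z, Relation.ReflTransGen G.Arrow (p.getVert (k + 1)) d) ∧
    (¬ (G.Arrow (p.getVert k) (p.getVert (k + 1)) ∧
        G.Arrow (p.getVert (k + 2)) (p.getVert (k + 1))) →
      p.getVert (k + 1) ∉ Z)

/-- `A` and `B` are d-separated by `Z`: every path (with arbitrary edge directions and without
repeated vertices) between a vertex of `A` and a vertex of `B` is blocked by `Z`. -/
def DSeparated (G : DAG V) (A B Z : Set V) : Prop :=
  ∀ a ∈ A, ∀ b ∈ B, ∀ p : G.skeleton.Walk a b, p.IsPath → ¬ G.IsActive Z p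

/-- Markov equivalence: the same d-separations between pairwise disjoint vertex sets. -/
def MarkovEquivalent (G₁ G₂ : DAG V) : Prop :=
  ∀ A B Z : Set V, Disjoint A B → Disjoint A Z → Disjoint B Z →
    (G₁.DSeparated A B Z ↔ G₂.DSeparated A B Z)

/-- Markov equivalence as an equivalence relation on the DAGs on `V`. -/
def markovSetoid (V : Type*) : Setoid (DAG V) where
  r := MarkovEquivalent
  iseqv :=
    ⟨fun _ _ _ _ _ _ _ => Iff.rfl,
     fun h A B Z h₁ h₂ h₃ => (h A B Z h₁ h₂ h₃).symm,
     fun h h' A B Z h₁ h₂ h₃ => (h A B Z h₁ h₂ h₃).trans (h' A B Z h₁ h₂ h₃)⟩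

end DAG

/-!
The covariance matrix of `X_b = ε_b + ∑ p, u p * ε_p` and `X_p = ε_p` for `p ≠ b` lies in the
Lyapunov model of every graph in which the support of `u` consists of parents of `b`. If `u` is
supported on a single vertex `a`, then in turn every graph whose model contains this matrix has an
edge between `a` and `b`; if `u` is supported on two vertices `a` and `c` which are not adjacent in
the graph, then the edge is `a → b`. Hence the model determines the skeleton and the unshielded
colliders.

By Verma and Pearl, these determine the d-separations: among the shortest unblocked walks between
two vertices, choose one whose colliders are as close to `Z` as possible along directed paths.
Minimal length makes the walk have the same colliders in both graphs, and closeness to `Z` orients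
the directed paths from these colliders to `Z` in the same way.
-/

namespace DAG

section Arrow

variable {V : Type*} {G : DAG V} {a b c : V}

theorem Arrow.asymm (h : G.Arrow a b) : ¬ G.Arrow b a := fun h' =>
  G.acyclic a (.tail (.single h) h')

theorem Arrow.not_arrow_of_arrow (hab : G.Arrow a b) (hbc : G.Arrow b c) : ¬ G.Arrow c a :=
  fun hca => G.acyclic a (.tail (.tail (.single hab) hbc) hca)

theorem skeleton_adj : G.skeleton.Adj a b ↔ G.Arrow a b ∨ G.Arrow b a := by
  simp only [skeleton, Digraph.toSimpleGraphInclusive, SimpleGraph.fromRel_adj, Arrow]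
  grind

theorem Arrow.skeleton_adj (h : G.Arrow a b) : G.skeleton.Adj a b := DAG.skeleton_adj.2 (.inl h)

theorem Arrow.arrow_of_adj (hab : G.Arrow a b) (hbc : G.Arrow b c) (hac : G.skeleton.Adj a c) :
    G.Arrow a c :=
  (DAG.skeleton_adj.1 hac).resolve_right (hab.not_arrow_of_arrow hbc)

theorem apply_eq_zero_of_mem_sparse {M : Matrix V V ℝ} (hM : M ∈ G.sparse) (hab : a ≠ b)
    (h : ¬ G.Arrow a b) : M b a = 0 :=
  hM a b fun h' => h ⟨hab, h'⟩

end Arrow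

section Active

variable {V : Type*} {G : DAG V} {Z : Set V} {v w x y z : V} {n : ℕ} {f : ℕ → V}

/-- The middle vertex `y` of the triple `x, y, z` is a collider. -/
def Collider (G : DAG V) (x y z : V) : Prop := G.Arrow x y ∧ G.Arrow z y

/-- The vertex `y` belongs to `Z` or has a descendant in `Z`, so that conditioning on `Z` opens
the colliders at `y`. -/
def Reaches (G : DAG V) (Z : Set V) (y : V) : Prop :=
  ∃ d ∈ Z, Relation.ReflTransGen G.Arrow y d

/-- The middle vertex of the triple `x, y, z` does not block it given `Z`. -/
def Unblocked (G : DAG V) (Z : Set V) (x y z : V) : Prop :=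
  (G.Collider x y z → G.Reaches Z y) ∧ (¬ G.Collider x y z → y ∉ Z)

theorem reaches_of_mem (h : y ∈ Z) : G.Reaches Z y := ⟨y, h, .refl⟩

theorem Reaches.head (h : G.Arrow x y) : G.Reaches Z y → G.Reaches Z x
  | ⟨d, hd, hyd⟩ => ⟨d, hd, .head h hyd⟩

theorem Collider.symm (h : G.Collider x y z) : G.Collider z y x := ⟨h.2, h.1⟩

theorem Unblocked.symm (h : G.Unblocked Z x y z) : G.Unblocked Z z y x :=
  ⟨fun hc => h.1 hc.symm, fun hc => h.2 fun hc' => hc hc'.symm⟩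

theorem Unblocked.of_arrow_left (h : G.Unblocked Z w x y) (hxy : G.Arrow x y)
    (hxz : G.Arrow x z) : G.Unblocked Z w x z :=
  ⟨fun hc => (hxz.asymm hc.2).elim, fun _ => h.2 fun hc => hxy.asymm hc.2⟩

theorem Unblocked.of_arrow_right (h : G.Unblocked Z y z v) (hyz : G.Arrow y z)
    (hxz : G.Arrow x z) : G.Unblocked Z x z v :=
  ⟨fun hc => h.1 ⟨hyz, hc.2⟩, fun hc => h.2 fun hc' => hc ⟨hxz, hc'.2⟩⟩

theorem Unblocked.of_arrow_out (h : G.Unblocked Z y z v) (hzy : G.Arrow z y)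
    (hz : G.Reaches Z z) : G.Unblocked Z x z v :=
  ⟨fun _ => hz, fun _ => h.2 fun hc => hzy.asymm hc.1⟩

theorem Unblocked.glue (h : G.Unblocked Z w y x) (h' : G.Unblocked Z z y v)
    (hy : G.Collider w y v → G.Reaches Z y) : G.Unblocked Z w y v := by
  refine ⟨hy, fun hc hyZ => ?_⟩
  have hwy : G.Arrow w y := (not_imp_not.1 h.2 hyZ).1
  have hvy : G.Arrow v y := (not_imp_not.1 h'.2 hyZ).2
  exact hc ⟨hwy, hvy⟩

/-- The vertices `f 0, …, f n` are consecutively adjacent and none of the inner ones blocks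
given `Z`. Repetitions are allowed, and the values of `f` beyond `n` are irrelevant. -/
structure ActiveSeq (G : DAG V) (Z : Set V) (n : ℕ) (f : ℕ → V) : Prop where
  adj : ∀ k < n, G.skeleton.Adj (f k) (f (k + 1))
  unblocked : ∀ k, k + 2 ≤ n → G.Unblocked Z (f k) (f (k + 1)) (f (k + 2))

namespace ActiveSeq

theorem reverse (h : G.ActiveSeq Z n f) : G.ActiveSeq Z n (fun k => f (n - k)) where
  adj k hk := by
    have := (h.adj (n - (k + 1)) (by lia)).symm
    rwa [show n - (k + 1) + 1 = n - k by lia] at this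
  unblocked k hk := by
    have := (h.unblocked (n - (k + 2)) (by lia)).symm
    rwa [show n - (k + 2) + 1 = n - (k + 1) by lia,
      show n - (k + 2) + 2 = n - k by lia] at this

theorem take (h : G.ActiveSeq Z n f) {m : ℕ} (hm : m ≤ n) : G.ActiveSeq Z m f :=
  ⟨fun k hk => h.adj k (hk.trans_le hm), fun k hk => h.unblocked k (hk.trans hm)⟩

theorem shortcut (h : G.ActiveSeq Z n f) {i d : ℕ} (hid : i + d + 1 ≤ n)
    (hadj : G.skeleton.Adj (f i) (f (i + d + 1)))
    (hleft : ∀ k, k + 1 = i → G.Unblocked Z (f k) (f i) (f (i + d + 1)))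
    (hright : i + d + 2 ≤ n → G.Unblocked Z (f i) (f (i + d + 1)) (f (i + d + 2))) :
    G.ActiveSeq Z (n - d) (fun k => if k ≤ i then f k else f (k + d)) where
  adj k hk := by
    rcases lt_trichotomy k i with hki | rfl | hki
    · simpa [hki.le, Nat.succ_le_of_lt hki] using h.adj k (by lia)
    · simpa [Nat.add_right_comm k 1 d] using hadj
    · simpa [hki.not_ge, show ¬ k + 1 ≤ i by lia, Nat.add_right_comm k 1 d]
        using h.adj (k + d) (by lia)
  unblocked k hk := by
    have hk1 : k + 1 + d = k + d + 1 := by lia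
    have hk2 : k + 2 + d = k + d + 2 := by lia
    rcases lt_trichotomy k i with hki | rfl | hki
    · rcases (Nat.succ_le_of_lt hki).lt_or_eq with hki' | rfl
      · simpa [hki.le, hki'.le, Nat.succ_le_of_lt hki'] using h.unblocked k (by lia)
      · simpa [show k + 1 + d + 1 = k + 2 + d by lia] using hleft k rfl
    · simpa [hk1, hk2] using hright (by lia)
    · simpa [hki.not_ge, show ¬ k + 1 ≤ i by lia, show ¬ k + 2 ≤ i by lia, hk1, hk2]
        using h.unblocked (k + d) (by lia)

theorem reaches_or_transGen (h : G.ActiveSeq Z n f) {i j : ℕ} (hij : i ≤ j) (hj : j < n)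
    (ha : G.Arrow (f i) (f (i + 1))) :
    G.Reaches Z (f i) ∨
      Relation.TransGen G.Arrow (f i) (f (j + 1)) ∧ G.Arrow (f j) (f (j + 1)) := by
  induction j, hij using Nat.le_induction with
  | base => exact .inr ⟨.single ha, ha⟩
  | succ j _ ih =>
    rcases ih (by lia) with hr | ⟨hpath, hlast⟩
    · exact .inl hr
    rcases skeleton_adj.1 (h.adj (j + 1) hj) with hnext | hnext
    · exact .inr ⟨hpath.tail hnext, hnext⟩
    · obtain ⟨e, he, hje⟩ := (h.unblocked j (by lia)).1 ⟨hlast, hnext⟩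
      exact .inl ⟨e, he, hpath.to_reflTransGen.trans hje⟩

theorem reaches_of_eq (h : G.ActiveSeq Z n f) {i j : ℕ} (hij : i < j) (hj : j ≤ n)
    (heq : f i = f j) (ha : G.Arrow (f i) (f (i + 1))) : G.Reaches Z (f i) := by
  obtain ⟨j, rfl⟩ := Nat.exists_eq_add_one_of_ne_zero hij.ne_bot
  refine (h.reaches_or_transGen (Nat.le_of_lt_succ hij) hj ha).resolve_right fun hcycle => ?_
  exact G.acyclic _ (heq ▸ hcycle.1)

theorem replace (h : G.ActiveSeq Z n f) {k : ℕ} (hc : G.Collider (f k) (f (k + 1)) (f (k + 2)))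
    (hy : G.Reaches Z y) (hc' : G.Collider (f k) y (f (k + 2))) :
    G.ActiveSeq Z n (Function.update f (k + 1) y) where
  adj l hl := by
    rcases eq_or_ne l k with rfl | h1
    · simpa [Function.update_apply] using hc'.1.skeleton_adj
    rcases eq_or_ne l (k + 1) with rfl | h2
    · simpa [Function.update_apply] using hc'.2.skeleton_adj.symm
    simpa [Function.update_apply, h1, h2] using h.adj l hl
  unblocked l hl := by
    rcases eq_or_ne l k with rfl | h1
    · have : G.Unblocked Z (f l) y (f (l + 2)) := ⟨fun _ => hy, fun hn => (hn hc').elim⟩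
      simpa [Function.update_apply] using this
    rcases eq_or_ne l (k + 1) with rfl | h2
    · have := ((h.unblocked (k + 1) hl).symm.of_arrow_left hc.2 hc'.2).symm
      simpa [Function.update_apply] using this
    rcases eq_or_ne k (l + 1) with rfl | h3
    · have := (h.unblocked l hl).of_arrow_left hc.1 hc'.1
      simpa [Function.update_apply, show l ≠ l + 1 + 1 by lia] using this
    · simpa [Function.update_apply, h1, h2, h3.symm] using h.unblocked l hl

end ActiveSeq

theorem isActive_iff_activeSeq {a b : V} (p : G.skeleton.Walk a b) :
    G.IsActive Z p ↔ G.ActiveSeq Z p.length p.getVert :=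
  ⟨fun h => ⟨fun _ hk => p.adj_getVert_succ hk, h⟩, fun h => h.unblocked⟩

theorem exists_walk_getVert (S : SimpleGraph V) (h : ∀ k < n, S.Adj (f k) (f (k + 1))) :
    ∃ p : S.Walk (f 0) (f n), p.length = n ∧ ∀ k ≤ n, p.getVert k = f k := by
  induction n generalizing f with
  | zero => exact ⟨.nil, rfl, fun k hk => by simp [Nat.le_zero.1 hk]⟩
  | succ n ih =>
    obtain ⟨p, hlen, hvert⟩ := ih (f := fun k => f (k + 1)) fun k hk => h (k + 1) (by lia)
    refine ⟨.cons (h 0 n.succ_pos) p, by simp [hlen], fun k hk => ?_⟩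
    cases k with
    | zero => simp
    | succ k => simpa using hvert k (by lia)

theorem ActiveSeq.exists_isPath_isActive (h : G.ActiveSeq Z n f)
    (hinj : Set.InjOn f {k | k ≤ n}) :
    ∃ p : G.skeleton.Walk (f 0) (f n), p.IsPath ∧ G.IsActive Z p := by
  obtain ⟨p, hlen, hvert⟩ := exists_walk_getVert G.skeleton h.adj
  refine ⟨p, ?_, (isActive_iff_activeSeq p).2 ⟨fun _ hk => p.adj_getVert_succ hk, ?_⟩⟩
  · rw [← SimpleGraph.Walk.IsPath.getVert_injOn_iff, hlen]
    exact hinj.congr fun k hk => (hvert k hk).symm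
  · intro k hk
    rw [hlen] at hk
    rw [hvert k (by lia), hvert (k + 1) (by lia), hvert (k + 2) hk]
    exact h.unblocked k hk

end Active

section Shortest

variable {V : Type*} {G H : DAG V} {Z : Set V} {n i j k : ℕ} {f : ℕ → V}

/-- An active sequence of minimal length between its ends. -/
structure IsShortest (G : DAG V) (Z : Set V) (n : ℕ) (f : ℕ → V) : Prop
    extends G.ActiveSeq Z n f where
  le_length : ∀ {m g}, G.ActiveSeq Z m g → g 0 = f 0 → g m = f n → n ≤ m

namespace IsShortest

theorem reverse (h : G.IsShortest Z n f) : G.IsShortest Z n (fun k => f (n - k)) where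
  toActiveSeq := h.toActiveSeq.reverse
  le_length hg h0 hm := h.le_length hg.reverse (by simpa using hm) (by simpa using h0)

theorem exists_reverse_triple (h : G.IsShortest Z n f) (hk : k + 2 ≤ n) :
    ∃ g l, G.IsShortest Z n g ∧ l + 2 ≤ n ∧
      g l = f (k + 2) ∧ g (l + 1) = f (k + 1) ∧ g (l + 2) = f k :=
  ⟨_, n - (k + 2), h.reverse, by lia, congrArg f (by lia), congrArg f (by lia),
    congrArg f (by lia)⟩

theorem no_shortcut (h : G.IsShortest Z n f) {d : ℕ} (hd : 0 < d) (hid : i + d + 1 ≤ n)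
    (hadj : G.skeleton.Adj (f i) (f (i + d + 1)))
    (hleft : ∀ k, k + 1 = i → G.Unblocked Z (f k) (f i) (f (i + d + 1))) :
    ¬ (i + d + 2 ≤ n → G.Unblocked Z (f i) (f (i + d + 1)) (f (i + d + 2))) := by
  intro hright
  have := h.le_length (h.shortcut hid hadj hleft hright) (by simp)
    (by simp [show ¬ n - d ≤ i by lia, show n - d + d = n by lia])
  lia

theorem ne (h : G.IsShortest Z n f) (hij : i < j) (hj : j ≤ n) : f i ≠ f j := by
  intro heq
  rcases hj.lt_or_eq with hjn | rfl
  · obtain ⟨d, rfl⟩ := Nat.exists_eq_add_of_le hij.le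
    refine h.no_shortcut (i := i) (d := d) (by lia) (by lia) (heq ▸ h.adj _ hjn) ?_ ?_
    · rintro k rfl
      have hu' := h.unblocked (k + d) (by lia)
      rw [show k + d + 1 = k + 1 + d by lia, show k + d + 2 = k + 1 + d + 1 by lia, ← heq] at hu'
      refine (h.unblocked k (by lia)).glue hu' fun hc => ?_
      -- A loop leaving `f i` along an arrow runs into a collider, as it is not a directed cycle.
      rcases skeleton_adj.1 (h.adj (k + 1) (by lia)) with hnext | hnext
      · exact h.reaches_of_eq hij hj heq hnext
      · exact (h.unblocked k (by lia)).1 ⟨hc.1, hnext⟩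
    · intro hn
      have hu := h.unblocked (i + d) hn
      rwa [← heq] at hu
  · have := h.le_length (h.take hij.le) rfl heq
    lia

theorem injOn (h : G.IsShortest Z n f) : Set.InjOn f {k | k ≤ n} := by
  intro i hi j hj heq
  rcases lt_trichotomy i j with hij | hij | hij
  · exact (h.ne hij hj heq).elim
  · exact hij
  · exact (h.ne hij hi heq.symm).elim

theorem not_arrow_of_arrow (h : G.IsShortest Z n f) (hk : k + 2 ≤ n)
    (hxy : G.Arrow (f k) (f (k + 1))) : ¬ G.Arrow (f k) (f (k + 2)) := by
  intro hxz
  refine h.no_shortcut (d := 1) one_pos hk hxz.skeleton_adj ?_ fun hn => ?_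
  · rintro l rfl
    exact (h.unblocked l (by lia)).of_arrow_left hxy hxz
  · have hu := h.unblocked (k + 1) hn
    rcases skeleton_adj.1 (h.adj (k + 1) (by lia)) with hyz | hzy
    · exact hu.of_arrow_right hyz hxz
    · exact hu.of_arrow_out hzy (((h.unblocked k hk).1 ⟨hxy, hzy⟩).head hzy)

theorem not_adj_of_collider (h : G.IsShortest Z n f) (hk : k + 2 ≤ n)
    (hc : G.Collider (f k) (f (k + 1)) (f (k + 2))) : ¬ G.skeleton.Adj (f k) (f (k + 2)) := by
  rw [skeleton_adj, not_or]
  refine ⟨h.not_arrow_of_arrow hk hc.1, ?_⟩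
  obtain ⟨g, l, hg, hl, hgx, hgy, hgz⟩ := h.exists_reverse_triple hk
  rw [← hgx, ← hgz]
  exact hg.not_arrow_of_arrow hl (by rw [hgx, hgy]; exact hc.2)

theorem arrow_left_of_arrow (h : G.IsShortest Z n f) (hk : k + 2 ≤ n)
    (hxz : G.Arrow (f k) (f (k + 2))) : G.Arrow (f (k + 1)) (f k) :=
  (skeleton_adj.1 (h.adj k (by lia))).resolve_left fun hxy => h.not_arrow_of_arrow hk hxy hxz

theorem arrow_right_of_arrow (h : G.IsShortest Z n f) (hk : k + 2 ≤ n)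
    (hxz : G.Arrow (f k) (f (k + 2))) : G.Arrow (f (k + 1)) (f (k + 2)) :=
  (h.arrow_left_of_arrow hk hxz).arrow_of_adj hxz (h.adj (k + 1) (by lia))

theorem exists_collider_of_arrow (h : G.IsShortest Z n f) (hk : k + 2 ≤ n)
    (hxz : G.Arrow (f k) (f (k + 2))) :
    ∃ m, m + 1 = k ∧ G.Collider (f m) (f k) (f (k + 1)) ∧ ¬ G.skeleton.Adj (f m) (f (k + 2)) := by
  have hyz := h.arrow_right_of_arrow hk hxz
  obtain ⟨m, rfl, hm⟩ : ∃ m, m + 1 = k ∧ ¬ G.Unblocked Z (f m) (f k) (f (k + 2)) := by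
    by_contra! hleft
    exact h.no_shortcut (d := 1) one_pos hk hxz.skeleton_adj hleft
      fun hn => (h.unblocked (k + 1) hn).of_arrow_right hyz hxz
  have hc : G.Collider (f m) (f (m + 1)) (f (m + 2)) := by
    by_contra hc
    exact hm ⟨fun hc' => (hxz.asymm hc'.2).elim, fun _ => (h.unblocked m (by lia)).2 hc⟩
  refine ⟨m, rfl, hc, fun hadj => ?_⟩
  have hwz := hc.1.arrow_of_adj hxz hadj
  refine h.no_shortcut (d := 2) two_pos hk hadj ?_
    fun hn => (h.unblocked (m + 2) hn).of_arrow_right hyz hwz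
  rintro l rfl
  exact (h.unblocked l (by lia)).of_arrow_left hc.1 hwz

end IsShortest

/-- The two graphs have the same skeleton and the same unshielded colliders. -/
structure SamePattern (G H : DAG V) : Prop where
  adj_iff : ∀ a b, G.skeleton.Adj a b ↔ H.skeleton.Adj a b
  collider_iff : ∀ a b c, a ≠ c → ¬ G.skeleton.Adj a c → (G.Collider a b c ↔ H.Collider a b c)

namespace SamePattern

theorem symm (hGH : SamePattern G H) : SamePattern H G where
  adj_iff a b := (hGH.adj_iff a b).symm
  collider_iff a b c hac hn := (hGH.collider_iff a b c hac (by rwa [hGH.adj_iff])).symm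

theorem arrow_of_chain (hGH : SamePattern G H) {x y z : V} (hxz : x ≠ z)
    (hn : ¬ G.skeleton.Adj x z) (hyz : G.Arrow y z) (hxy : H.Arrow x y) : H.Arrow y z :=
  (skeleton_adj.1 ((hGH.adj_iff y z).1 hyz.skeleton_adj)).resolve_right fun hzy =>
    hyz.asymm ((hGH.collider_iff x y z hxz hn).2 ⟨hxy, hzy⟩).2

end SamePattern

theorem IsShortest.arrow_of_samePattern (h : G.IsShortest Z n f) (hGH : SamePattern G H)
    (hk : k + 2 ≤ n) (hxz : G.Arrow (f k) (f (k + 2))) : H.Arrow (f (k + 1)) (f (k + 2)) := by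
  obtain ⟨m, rfl, hc, hwz⟩ := h.exists_collider_of_arrow hk hxz
  have hcH : H.Collider (f m) (f (m + 1)) (f (m + 2)) :=
    (hGH.collider_iff _ _ _ (h.ne (by lia) (by lia)) (h.not_adj_of_collider (by lia) hc)).1 hc
  have hxzH : H.Arrow (f (m + 1)) (f (m + 3)) :=
    hGH.arrow_of_chain (h.ne (by lia) hk) hwz hxz hcH.1
  exact hcH.2.arrow_of_adj hxzH ((hGH.adj_iff _ _).1 (h.adj (m + 2) (by lia)))

theorem IsShortest.collider_iff (h : G.IsShortest Z n f) (hGH : SamePattern G H)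
    (hk : k + 2 ≤ n) :
    G.Collider (f k) (f (k + 1)) (f (k + 2)) ↔ H.Collider (f k) (f (k + 1)) (f (k + 2)) := by
  by_cases hadj : G.skeleton.Adj (f k) (f (k + 2))
  · refine iff_of_false (fun hc => h.not_adj_of_collider hk hc hadj) fun hc => ?_
    rcases skeleton_adj.1 hadj with hxz | hzx
    · exact (h.arrow_of_samePattern hGH hk hxz).asymm hc.2
    · obtain ⟨g, l, hg, hl, hgx, hgy, hgz⟩ := h.exists_reverse_triple hk
      rw [← hgx, ← hgy, ← hgz] at hc
      rw [← hgx, ← hgz] at hzx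
      exact (hg.arrow_of_samePattern hGH hl hzx).asymm hc.1
  · exact hGH.collider_iff _ _ _ (h.ne (by lia) hk) hadj

end Shortest

section Closest

variable {V : Type*} {G H : DAG V} {Z : Set V} {n k : ℕ} {f : ℕ → V} {y d : V}

/-- A directed path with `m` arrows leads from `y` into `Z`. -/
def ReachesIn (G : DAG V) (Z : Set V) : ℕ → V → Prop
  | 0, y => y ∈ Z
  | m + 1, y => ∃ d, G.Arrow y d ∧ G.ReachesIn Z m d

theorem ReachesIn.reaches : ∀ {m : ℕ} {y : V}, G.ReachesIn Z m y → G.Reaches Z y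
  | 0, _, h => reaches_of_mem h
  | _ + 1, _, ⟨_, hd, h⟩ => h.reaches.head hd

theorem Reaches.exists_reachesIn (h : G.Reaches Z y) : ∃ m, G.ReachesIn Z m y := by
  obtain ⟨d, hd, hyd⟩ := h
  induction hyd using Relation.ReflTransGen.head_induction_on with
  | refl => exact ⟨0, hd⟩
  | head hab _ ih =>
    obtain ⟨m, hm⟩ := ih
    exact ⟨m + 1, _, hab, hm⟩

/-- The length of a shortest directed path from `y` into `Z`. It has the junk value `0` if
there is no such path. -/
noncomputable def height (G : DAG V) (Z : Set V) (y : V) : ℕ := sInf {m | G.ReachesIn Z m y}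

theorem Reaches.reachesIn_height (h : G.Reaches Z y) : G.ReachesIn Z (G.height Z y) y :=
  Nat.sInf_mem (s := {m | G.ReachesIn Z m y}) h.exists_reachesIn

theorem height_le_of_arrow (hyd : G.Arrow y d) (hd : G.Reaches Z d) :
    G.height Z y ≤ G.height Z d + 1 :=
  Nat.sInf_le ⟨d, hyd, hd.reachesIn_height⟩

theorem Reaches.exists_arrow_height (h : G.Reaches Z y) (hy : y ∉ Z) :
    ∃ d, G.Arrow y d ∧ G.Reaches Z d ∧ G.height Z y = G.height Z d + 1 := by
  have hm := h.reachesIn_height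
  cases hh : G.height Z y with
  | zero => exact (hy (by rwa [hh] at hm)).elim
  | succ m =>
    rw [hh] at hm
    obtain ⟨d, hyd, hd⟩ := hm
    have hle : G.height Z d ≤ m := Nat.sInf_le hd
    have hge := height_le_of_arrow hyd hd.reaches
    exact ⟨d, hyd, hd.reaches, by lia⟩

theorem SamePattern.reaches_of_arrow (hGH : SamePattern G H) (hyd : G.Arrow y d)
    (hydH : H.Arrow y d) (hd : G.Reaches Z d) (hh : G.height Z y = G.height Z d + 1) :
    H.Reaches Z d := by
  induction hm : G.height Z d generalizing y d with
  | zero => exact reaches_of_mem (by simpa only [hm, ReachesIn] using hd.reachesIn_height)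
  | succ m ih =>
    by_cases hz : d ∈ Z
    · exact reaches_of_mem hz
    obtain ⟨e, hde, he, hhe⟩ := hd.exists_arrow_height hz
    have hye : ¬ G.skeleton.Adj y e := fun hadj => by
      have := height_le_of_arrow (hyd.arrow_of_adj hde hadj) he
      lia
    have hne : y ≠ e := fun h => hyd.asymm (h ▸ hde)
    have hdeH : H.Arrow d e := hGH.arrow_of_chain hne hye hde hydH
    exact (ih hde hdeH he hhe (by lia)).head hdeH

/-- A shortest active sequence whose vertices are, in total, as close to `Z` as possible along
directed paths. This makes the directed paths from its colliders into `Z` survive in all graphs with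
the same pattern. -/
structure IsClosest (G : DAG V) (Z : Set V) (n : ℕ) (f : ℕ → V) : Prop
    extends G.IsShortest Z n f where
  sum_height_le : ∀ {g}, G.ActiveSeq Z n g → g 0 = f 0 → g n = f n →
    ∑ k ∈ Finset.range n, G.height Z (f k) ≤ ∑ k ∈ Finset.range n, G.height Z (g k)

theorem ActiveSeq.exists_isClosest (h : G.ActiveSeq Z n f) :
    ∃ m g, G.IsClosest Z m g ∧ g 0 = f 0 ∧ g m = f n := by
  classical
  have hex : ∃ m g, G.ActiveSeq Z m g ∧ g 0 = f 0 ∧ g m = f n := ⟨n, f, h, rfl, rfl⟩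
  obtain ⟨g, ⟨hg, hg0, hgm⟩, hmin⟩ := exists_minimalFor_of_wellFoundedLT
    (fun g : ℕ → V => G.ActiveSeq Z (Nat.find hex) g ∧ g 0 = f 0 ∧ g (Nat.find hex) = f n)
    (fun g => ∑ k ∈ Finset.range (Nat.find hex), G.height Z (g k)) (Nat.find_spec hex)
  refine ⟨Nat.find hex, g, ⟨⟨hg, fun {m g'} hg' h0 hm => ?_⟩, fun {g'} hg' h0 hm => ?_⟩, hg0, hgm⟩
  · exact Nat.find_min' hex ⟨g', hg', h0.trans hg0, hm.trans hgm⟩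
  · exact (le_total _ _).elim id (hmin ⟨hg', h0.trans hg0, hm.trans hgm⟩)

theorem IsClosest.not_collider_of_height_lt (h : G.IsClosest Z n f) (hk : k + 2 ≤ n)
    (hc : G.Collider (f k) (f (k + 1)) (f (k + 2))) (hd : G.Reaches Z d)
    (hlt : G.height Z d < G.height Z (f (k + 1))) : ¬ G.Collider (f k) d (f (k + 2)) := by
  intro hc'
  refine (h.sum_height_le (h.replace hc hd hc') (by simp)
    (by simp [show n ≠ k + 1 by lia])).not_gt ?_
  refine Finset.sum_lt_sum (fun l _ => ?_) ⟨k + 1, Finset.mem_range.2 hk, by simpa using hlt⟩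
  rcases eq_or_ne l (k + 1) with rfl | hl
  · simpa using hlt.le
  · simp [hl]

theorem IsClosest.reaches_of_samePattern (h : G.IsClosest Z n f) (hGH : SamePattern G H)
    (hk : k + 2 ≤ n) (hc : G.Collider (f k) (f (k + 1)) (f (k + 2))) :
    H.Reaches Z (f (k + 1)) := by
  by_cases hz : f (k + 1) ∈ Z
  · exact reaches_of_mem hz
  obtain ⟨d, hyd, hd, hh⟩ := ((h.unblocked k hk).1 hc).exists_arrow_height hz
  have hcH : H.Collider (f k) (f (k + 1)) (f (k + 2)) := (h.collider_iff hGH hk).1 hc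
  suffices hydH : H.Arrow (f (k + 1)) d from (hGH.reaches_of_arrow hyd hydH hd hh).head hydH
  have hxd : f k ≠ d := fun h' => hc.1.asymm (h' ▸ hyd)
  have hzd : f (k + 2) ≠ d := fun h' => hc.2.asymm (h' ▸ hyd)
  by_cases hadj_x : G.skeleton.Adj (f k) d
  · have hadj_z : ¬ G.skeleton.Adj (f (k + 2)) d := fun hadj_z =>
      h.not_collider_of_height_lt hk hc hd (by lia)
        ⟨hc.1.arrow_of_adj hyd hadj_x, hc.2.arrow_of_adj hyd hadj_z⟩
    exact hGH.arrow_of_chain hzd hadj_z hyd hcH.2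
  · exact hGH.arrow_of_chain hxd hadj_x hyd hcH.1

theorem IsClosest.activeSeq_of_samePattern (h : G.IsClosest Z n f) (hGH : SamePattern G H) :
    H.ActiveSeq Z n f where
  adj k hk := (hGH.adj_iff _ _).1 (h.adj k hk)
  unblocked k hk := by
    rw [Unblocked, ← h.collider_iff hGH hk]
    exact ⟨h.reaches_of_samePattern hGH hk, (h.unblocked k hk).2⟩

theorem SamePattern.exists_isPath_isActive (hGH : SamePattern G H) {a b : V}
    {p : G.skeleton.Walk a b} (hp : G.IsActive Z p) :
    ∃ q : H.skeleton.Walk a b, q.IsPath ∧ H.IsActive Z q := by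
  obtain ⟨m, g, hg, h0, hm⟩ := ((isActive_iff_activeSeq p).1 hp).exists_isClosest
  obtain rfl : g 0 = a := h0.trans p.getVert_zero
  obtain rfl : g m = b := hm.trans p.getVert_length
  exact (hg.activeSeq_of_samePattern hGH).exists_isPath_isActive hg.injOn

theorem SamePattern.dSeparated (hGH : SamePattern G H) {A B : Set V}
    (h : H.DSeparated A B Z) : G.DSeparated A B Z := by
  intro a ha b hb p _ hp
  obtain ⟨q, hq, hqZ⟩ := hGH.exists_isPath_isActive hp
  exact h a ha b hb q hq hqZ

theorem SamePattern.markovEquivalent (hGH : SamePattern G H) : MarkovEquivalent G H :=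
  fun _ _ _ _ _ _ => ⟨hGH.symm.dSeparated, hGH.dSeparated⟩

end Closest

section Lyapunov

open Matrix

variable {V : Type*} [Fintype V] [DecidableEq V]

theorem exists_vecMul_eq_smul_of_mem_spectrum {K : Type*} [Field K] {M : Matrix V V K} {z : K}
    (hz : z ∈ spectrum K M) : ∃ v ≠ 0, v ᵥ* M = z • v := by
  rw [spectrum.mem_iff, isUnit_iff_isUnit_det, isUnit_iff_ne_zero, not_not,
    ← exists_vecMul_eq_zero_iff] at hz
  obtain ⟨v, hv, hzv⟩ := hz
  refine ⟨v, hv, ?_⟩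
  rwa [vecMul_sub, Algebra.algebraMap_eq_smul_one, vecMul_smul, vecMul_one, sub_eq_zero,
    eq_comm] at hzv

open scoped ComplexOrder in
/-- Pairing the Lyapunov equation with a left eigenvector of `M` for `z` turns it into
`2 re z * q_S + q_C = 0`, where `q_S` and `q_C` are positive values of the two Hermitian forms. -/
theorem re_neg_of_mem_spectrum_of_lyapunov {𝕜 : Type*} [RCLike 𝕜] {M S C : Matrix V V 𝕜}
    (hS : S.PosDef) (hC : C.PosDef) (h : M * S + S * Mᴴ + C = 0) {z : 𝕜}
    (hz : z ∈ spectrum 𝕜 M) : RCLike.re z < 0 := by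
  obtain ⟨v, hv, hzv⟩ := exists_vecMul_eq_smul_of_mem_spectrum hz
  have hzv' : Mᴴ *ᵥ star v = star z • star v := by rw [← star_vecMul, hzv, star_smul]
  have hqS : 0 < v ⬝ᵥ S *ᵥ star v := by
    simpa using hS.dotProduct_mulVec_pos (star_ne_zero.2 hv)
  have hqC : 0 < v ⬝ᵥ C *ᵥ star v := by
    simpa using hC.dotProduct_mulVec_pos (star_ne_zero.2 hv)
  have hform : z * (v ⬝ᵥ S *ᵥ star v) + star z * (v ⬝ᵥ S *ᵥ star v) + v ⬝ᵥ C *ᵥ star v = 0 := by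
    calc _ = v ⬝ᵥ (M * S + S * Mᴴ + C) *ᵥ star v := by
          rw [add_mulVec, add_mulVec, dotProduct_add, dotProduct_add, ← mulVec_mulVec,
            ← mulVec_mulVec, dotProduct_mulVec v M, hzv, hzv', smul_dotProduct, mulVec_smul,
            dotProduct_smul, smul_eq_mul, smul_eq_mul]
      _ = 0 := by rw [h, zero_mulVec, dotProduct_zero]
  obtain ⟨hqS_re, hqS_im⟩ := RCLike.pos_iff.1 hqS
  obtain ⟨hqC_re, -⟩ := RCLike.pos_iff.1 hqC
  have hre := congrArg RCLike.re hform
  simp only [map_add, RCLike.mul_re, hqS_im, RCLike.star_def, RCLike.conj_re, mul_zero, sub_zero,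
    map_zero] at hre
  by_contra! hz_nonneg
  have := mul_nonneg hz_nonneg hqS_re.le
  linarith

open scoped MatrixOrder ComplexOrder in
theorem posDef_map_algebraMap (𝕜 : Type*) [RCLike 𝕜] {n : Type*} [Finite n] {A : Matrix n n ℝ}
    (hA : A.PosDef) : (A.map (algebraMap ℝ 𝕜)).PosDef := by
  classical
  have := Fintype.ofFinite n
  have hunit : IsUnit (A.map (algebraMap ℝ 𝕜)) := hA.isUnit.map (algebraMap ℝ 𝕜).mapMatrix
  refine (PosSemidef.posDef_iff_isUnit ?_).2 hunit
  obtain ⟨B, rfl⟩ := CStarAlgebra.nonneg_iff_eq_star_mul_self.1 hA.posSemidef.nonneg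
  rw [star_eq_conjTranspose, Matrix.map_mul, conjTranspose_map _ algebraMap_star_comm]
  exact posSemidef_conjTranspose_mul_self _

theorem isStable_of_lyapunov {M S C : Matrix V V ℝ} (hS : S.PosDef) (hC : C.PosDef)
    (h : M * S + S * Mᵀ + C = 0) : IsStable M := by
  intro z hz
  refine re_neg_of_mem_spectrum_of_lyapunov (posDef_map_algebraMap ℂ hS)
    (posDef_map_algebraMap ℂ hC) ?_ hz
  have hmap := congrArg (fun A => A.map (algebraMap ℝ ℂ)) h
  simpa only [Matrix.map_add _ (map_add _), Matrix.map_mul, Matrix.map_zero _ (map_zero _),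
    ← conjTranspose_eq_transpose_of_trivial, conjTranspose_map _ algebraMap_star_comm] using hmap

/-- For `u b = 0`, the covariance matrix of the vector with entries `X_b = ε_b + ∑ p, u p * ε_p`
and `X_p = ε_p` for `p ≠ b`, where the `ε_p` are uncorrelated with unit variances. It serves to
correlate a vertex `b` with some of its parents. -/
def starCov (b : V) (u : V → ℝ) : Matrix V V ℝ :=
  (1 + vecMulVec (Pi.single b 1) u) * (1 + vecMulVec (Pi.single b 1) u)ᵀ

variable {b : V} {u d : V → ℝ}

theorem transpose_starCov (b : V) (u : V → ℝ) : (starCov b u)ᵀ = starCov b u := by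
  rw [starCov, transpose_mul, transpose_transpose]

theorem posDef_starCov (hb : u b = 0) : (starCov b u).PosDef := by
  rw [starCov, ← conjTranspose_eq_transpose_of_trivial]
  refine PosDef.mul_conjTranspose_self _ (vecMul_injective_of_isUnit ?_)
  refine IsUnit.of_mul_eq_one (1 - vecMulVec (Pi.single b 1) u) ?_
  have hsq : vecMulVec (Pi.single b 1) u * vecMulVec (Pi.single b 1) u = 0 := by
    rw [vecMulVec_mul_vecMulVec, dotProduct_single, hb, zero_mul, zero_smul, vecMulVec_zero]
  rw [add_mul, mul_sub, mul_sub, hsq, mul_one, mul_one, one_mul, sub_zero, sub_add_cancel]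

theorem mul_starCov (M : Matrix V V ℝ) (b : V) (u : V → ℝ) :
    M * starCov b u = M + vecMulVec (M.col b) u +
      vecMulVec (M *ᵥ u + (u ⬝ᵥ u) • M.col b) (Pi.single b 1) := by
  rw [starCov, transpose_add, transpose_vecMulVec, transpose_one, ← Matrix.mul_assoc, mul_add,
    mul_add, mul_one, mul_one, add_mul, mul_vecMulVec, mulVec_single_one, mul_vecMulVec,
    vecMulVec_mul_vecMulVec, add_vecMulVec, smul_vecMulVec, vecMulVec_smul]

theorem mul_starCov_apply_of_ne (M : Matrix V V ℝ) (i : V) {j : V} (hj : j ≠ b) :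
    (M * starCov b u) i j = M i j + M i b * u j := by
  simp [mul_starCov, vecMulVec_apply, hj]

theorem mul_starCov_apply_self (M : Matrix V V ℝ) (hb : u b = 0) (i : V) :
    (M * starCov b u) i b = (M *ᵥ u) i + (1 + u ⬝ᵥ u) * M i b := by
  simp only [mul_starCov, Matrix.add_apply, vecMulVec_apply, col_apply, hb, Pi.add_apply,
    Pi.smul_apply, smul_eq_mul, Pi.single_eq_same]
  ring

/-- For `u b = 0`, a drift matrix which, together with the volatility matrix `diagonal d`, has the
stationary covariance matrix `starCov b u`. Its nonzero off-diagonal entries lie in row `b`, on the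
support of `u`. -/
noncomputable def starDrift (d : V → ℝ) (b : V) (u : V → ℝ) : Matrix V V ℝ :=
  -(1 / 2 : ℝ) • diagonal d + vecMulVec (Pi.single b 1) ((1 / 2 : ℝ) • (d * u) +
    ((d b + u ⬝ᵥ (d * u)) / 2) • u - (u ⬝ᵥ (d * u) / 2) • Pi.single b 1)

theorem starDrift_mulVec_single (hb : u b = 0) :
    starDrift d b u *ᵥ Pi.single b 1 = -((d b + u ⬝ᵥ (d * u)) / 2) • Pi.single b 1 := by
  have hw : ((1 / 2 : ℝ) • (d * u) + ((d b + u ⬝ᵥ (d * u)) / 2) • u -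
      (u ⬝ᵥ (d * u) / 2) • Pi.single b 1) ⬝ᵥ Pi.single b 1 = -(u ⬝ᵥ (d * u) / 2) := by
    simp [hb]
  rw [starDrift, add_mulVec, smul_mulVec, vecMulVec_mulVec, hw, diagonal_mulVec_single,
    op_smul_eq_smul, mul_one, ← mul_one (d b), ← smul_eq_mul, Pi.single_smul]
  module

theorem starDrift_mulVec (hb : u b = 0) :
    starDrift d b u *ᵥ u = -(1 / 2 : ℝ) • (d * u) +
      (u ⬝ᵥ (d * u) / 2 + (d b + u ⬝ᵥ (d * u)) / 2 * (u ⬝ᵥ u)) • Pi.single b 1 := by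
  have hdu : diagonal d *ᵥ u = d * u := funext fun i => mulVec_diagonal d u i
  rw [starDrift, add_mulVec, smul_mulVec, hdu, vecMulVec_mulVec, op_smul_eq_smul, sub_dotProduct,
    add_dotProduct, smul_dotProduct, smul_dotProduct, smul_dotProduct, single_dotProduct, hb,
    dotProduct_comm (d * u)]
  module

theorem starDrift_mul_starCov (hb : u b = 0) :
    starDrift d b u * starCov b u = -(1 / 2 : ℝ) • diagonal d +
      (1 / 2 : ℝ) • (vecMulVec (Pi.single b 1) (d * u) - vecMulVec (d * u) (Pi.single b 1)) := by
  rw [mul_starCov, ← mulVec_single_one, starDrift_mulVec_single hb, starDrift_mulVec hb, starDrift]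
  simp only [add_vecMulVec, vecMulVec_add, vecMulVec_sub, smul_vecMulVec, vecMulVec_smul]
  module

theorem lyapunov_starCov (hb : u b = 0) :
    starDrift d b u * starCov b u + starCov b u * (starDrift d b u)ᵀ + diagonal d = 0 := by
  have : starCov b u * (starDrift d b u)ᵀ = (starDrift d b u * starCov b u)ᵀ := by
    rw [transpose_mul, transpose_starCov]
  rw [this, starDrift_mul_starCov hb]
  simp only [transpose_add, transpose_smul, transpose_sub, transpose_vecMulVec, diagonal_transpose]
  module

theorem starCov_mem_lyapunovModel {G : DAG V} (hd : ∀ i, 0 < d i) (hb : u b = 0)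
    (hu : ∀ p, u p ≠ 0 → G.Adj p b) : starCov b u ∈ lyapunovModel (diagonal d) G := by
  refine ⟨posDef_starCov hb, starDrift d b u, fun i j hij => ?_,
    isStable_of_lyapunov (posDef_starCov hb) (PosDef.diagonal hd) (lyapunov_starCov hb),
    lyapunov_starCov hb⟩
  have hji : j ≠ i := fun h => hij (h ▸ G.loop j)
  rcases eq_or_ne j b with rfl | hj
  · have hui : u i = 0 := not_imp_comm.1 (hu i) hij
    simp [starDrift, vecMulVec_apply, hji, hji.symm, hui]
  · simp [starDrift, vecMulVec_apply, hji, hj]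

omit [DecidableEq V] in
theorem lyapunov_apply {R : Type*} [CommSemiring R] {M S C : Matrix V V R} (hS : Sᵀ = S)
    (h : M * S + S * Mᵀ + C = 0) (i j : V) : (M * S) i j + (M * S) j i + C i j = 0 := by
  have hSM : S * Mᵀ = (M * S)ᵀ := by rw [transpose_mul, hS]
  rw [hSM] at h
  exact congrFun (congrFun h i) j

theorem adj_of_starCov_single_mem_lyapunovModel {G : DAG V} {a : V} (hd : ∀ i, 0 < d i)
    (hab : a ≠ b) (h : starCov b (Pi.single a 1) ∈ lyapunovModel (diagonal d) G) :
    G.skeleton.Adj a b := by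
  by_contra hadj
  rw [skeleton_adj, not_or] at hadj
  obtain ⟨-, M, hM, -, hL⟩ := h
  have hMab : M a b = 0 := apply_eq_zero_of_mem_sparse hM hab.symm hadj.2
  have hMba : M b a = 0 := apply_eq_zero_of_mem_sparse hM hab hadj.1
  have hu : (Pi.single a 1 : V → ℝ) b = 0 := Pi.single_eq_of_ne hab.symm 1
  have hcol_a (i : V) : (M * starCov b (Pi.single a 1)) i a = M i a + M i b := by
    simp [mul_starCov_apply_of_ne, hab]
  have hcol_b (i : V) : (M * starCov b (Pi.single a 1)) i b = M i a + 2 * M i b := by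
    simp [mul_starCov_apply_self _ hu, one_add_one_eq_two]
  have haa := lyapunov_apply (transpose_starCov b _) hL a a
  have hbb := lyapunov_apply (transpose_starCov b _) hL b b
  have hab_eq := lyapunov_apply (transpose_starCov b _) hL a b
  rw [hcol_a, hMab, diagonal_apply_eq] at haa
  rw [hcol_b, hMba, diagonal_apply_eq] at hbb
  rw [hcol_a, hcol_b, hMab, hMba, diagonal_apply_ne _ hab] at hab_eq
  -- The three entries read `M a a < 0`, `M b b < 0` and `M a a + M b b = 0`.
  linarith [hd a, hd b]

theorem mul_starCov_pair_apply_self (M : Matrix V V ℝ) {a c : V} (hab : a ≠ b) (hcb : c ≠ b)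
    (hac : a ≠ c) (i : V) : (M * starCov b (Pi.single a 1 + Pi.single c 1)) i b =
      M i a + M i c + 3 * M i b := by
  set u : V → ℝ := Pi.single a 1 + Pi.single c 1
  have hub : u b = 0 := by simp [u, hab.symm, hcb.symm]
  have huu : u ⬝ᵥ u = 2 := by simp [u, hac, hac.symm, one_add_one_eq_two]
  have hMu : (M *ᵥ u) i = M i a + M i c := by simp [u, mulVec_add]
  rw [mul_starCov_apply_self M hub, hMu, huu]
  norm_num

theorem arrow_of_starCov_pair_mem_lyapunovModel {G : DAG V} {a c : V} (hd : ∀ i, 0 < d i)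
    (hab : a ≠ b) (hcb : c ≠ b) (hac : a ≠ c) (hadj : ¬ G.skeleton.Adj a c)
    (h : starCov b (Pi.single a 1 + Pi.single c 1) ∈ lyapunovModel (diagonal d) G) :
    G.Arrow a b := by
  by_contra hn
  rw [skeleton_adj, not_or] at hadj
  obtain ⟨-, M, hM, -, hL⟩ := h
  set u : V → ℝ := Pi.single a 1 + Pi.single c 1
  have hMba : M b a = 0 := apply_eq_zero_of_mem_sparse hM hab hn
  have hMca : M c a = 0 := apply_eq_zero_of_mem_sparse hM hac hadj.1
  have hMac : M a c = 0 := apply_eq_zero_of_mem_sparse hM hac.symm hadj.2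
  have hcol_a (i : V) : (M * starCov b u) i a = M i a + M i b := by
    simp [mul_starCov_apply_of_ne, u, hab, hac]
  have hcol_c (i : V) : (M * starCov b u) i c = M i c + M i b := by
    simp [mul_starCov_apply_of_ne, u, hcb, hac.symm]
  have hcol_b (i : V) : (M * starCov b u) i b = M i a + M i c + 3 * M i b :=
    mul_starCov_pair_apply_self M hab hcb hac i
  have hsymm := transpose_starCov b u
  have haa := lyapunov_apply hsymm hL a a
  have hbb := lyapunov_apply hsymm hL b b
  have hcc := lyapunov_apply hsymm hL c c
  have hab_eq := lyapunov_apply hsymm hL a b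
  have hbc_eq := lyapunov_apply hsymm hL b c
  have hac_eq := lyapunov_apply hsymm hL a c
  simp only [hcol_a, hcol_b, hcol_c, hMba, hMca, hMac, diagonal_apply_eq, diagonal_apply_ne _ hab,
    diagonal_apply_ne _ hcb.symm, diagonal_apply_ne _ hac] at haa hbb hcc hab_eq hbc_eq hac_eq
  have hMcb_or : M c b = 0 ∨ M b c = 0 := by
    by_cases hc : G.Arrow c b
    · exact .inl (apply_eq_zero_of_mem_sparse hM hcb.symm hc.asymm)
    · exact .inr (apply_eq_zero_of_mem_sparse hM hcb hc)
  rcases hMcb_or with h0 | h0 <;> linarith [hd a, hd b, hd c]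

variable {G H : DAG V}

theorem skeleton_adj_of_lyapunovModel_subset (hd : ∀ i, 0 < d i)
    (h : lyapunovModel (diagonal d) G ⊆ lyapunovModel (diagonal d) H) {a : V}
    (hab : G.skeleton.Adj a b) : H.skeleton.Adj a b := by
  wlog harrow : G.Arrow a b generalizing a b
  · exact (this hab.symm ((skeleton_adj.1 hab).resolve_left harrow)).symm
  refine adj_of_starCov_single_mem_lyapunovModel hd hab.ne
    (h (starCov_mem_lyapunovModel hd (Pi.single_eq_of_ne hab.ne' 1) fun p hp => ?_))
  obtain rfl : p = a := not_imp_comm.1 (Pi.single_eq_of_ne (M := fun _ => ℝ) · 1) hp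
  exact harrow.2

theorem arrow_of_lyapunovModel_subset (hd : ∀ i, 0 < d i)
    (h : lyapunovModel (diagonal d) G ⊆ lyapunovModel (diagonal d) H) {a c : V} (hac : a ≠ c)
    (hadj : ¬ H.skeleton.Adj a c) (hc : G.Collider a b c) : H.Arrow a b := by
  obtain ⟨⟨hab, hGab⟩, hcb, hGcb⟩ := hc
  refine arrow_of_starCov_pair_mem_lyapunovModel hd hab hcb hac hadj
    (h (starCov_mem_lyapunovModel hd (by simp [hab.symm, hcb.symm]) fun p hp => ?_))
  rcases eq_or_ne p a with rfl | hpa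
  · exact hGab
  · obtain rfl : p = c := by
      by_contra hpc
      simp [hpa, hpc] at hp
    exact hGcb

theorem collider_of_lyapunovModel_subset (hd : ∀ i, 0 < d i)
    (h : lyapunovModel (diagonal d) G ⊆ lyapunovModel (diagonal d) H) {a c : V} (hac : a ≠ c)
    (hadj : ¬ H.skeleton.Adj a c) (hc : G.Collider a b c) : H.Collider a b c :=
  ⟨arrow_of_lyapunovModel_subset hd h hac hadj hc,
    arrow_of_lyapunovModel_subset hd h hac.symm (fun h' => hadj h'.symm) hc.symm⟩

theorem samePattern_of_modelEquivalent (hd : ∀ i, 0 < d i)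
    (h : ModelEquivalent (diagonal d) G H) : SamePattern G H := by
  have hadj (a b : V) : G.skeleton.Adj a b ↔ H.skeleton.Adj a b :=
    ⟨skeleton_adj_of_lyapunovModel_subset hd h.subset,
      skeleton_adj_of_lyapunovModel_subset hd h.superset⟩
  refine ⟨hadj, fun a b c hac hn => ⟨?_, ?_⟩⟩
  · exact collider_of_lyapunovModel_subset hd h.subset hac (by rwa [← hadj])
  · exact collider_of_lyapunovModel_subset hd h.superset hac hn

end Lyapunov

end DAG

/-- For every diagonal positive definite volatility matrix, the partition of the DAGs on `V` into
Lyapunov model equivalence classes refines the partition into Markov equivalence classes;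
that is, DAGs which are not Markov equivalent are not Lyapunov model equivalent. -/
theorem mainTheorem5 {V : Type*} [Fintype V] [DecidableEq V] (C : Matrix V V ℝ)
    (hC : C.PosDef) (hdiag : C.IsDiag) :
    DAG.modelSetoid C ≤ DAG.markovSetoid V ∧
      ∀ G₁ G₂ : DAG V, ¬ DAG.MarkovEquivalent G₁ G₂ → ¬ DAG.ModelEquivalent C G₁ G₂ := by
  obtain ⟨d, rfl⟩ : ∃ d, C = Matrix.diagonal d := ⟨_, hdiag.diagonal_diag.symm⟩
  have hd : ∀ i, 0 < d i := Matrix.posDef_diagonal_iff.1 hC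
  have hrefine (G₁ G₂ : DAG V) (h : DAG.ModelEquivalent (Matrix.diagonal d) G₁ G₂) :
      DAG.MarkovEquivalent G₁ G₂ := (DAG.samePattern_of_modelEquivalent hd h).markovEquivalent
  exact ⟨fun {G₁ G₂} => hrefine G₁ G₂, fun G₁ G₂ => mt (hrefine G₁ G₂)⟩
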